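/- Let $k$ be an algebraically closed field of characteristic zero, $R=k[x_0,\dots,x_r]$ and $\bar R=k[x_1,\dots,x_r]$, with the graded lexicographic order (GLex) for which $x_0>x_1>\cdots>x_r$. For a homogeneous ideal $J$ of a polynomial ring in $n$ variables over $k$, $\mathrm{Gin}(J)=\mathrm{Gin}_{\mathrm{GLex}}(J)$ denotes its generic initial ideal, i.e. the common value of $\mathrm{in}_{\mathrm{GLex}}(g(J))$ for all $g$ in some nonempty Zariski open subset of $GL_n(k)$, and $M(J)$ denotes the maximal degree of a minimal monomial generator of $\mathrm{Gin}(J)$, with $M(0)=0$. We say that $J$ is in generic coordinates if the identity belongs to a Zariski open set of $g\in GL_n(k)$ with $\mathrm{in}_{\mathrm{GLex}}(g(J))=\mathrm{Gin}(J)$. For a homogeneous ideal $I\subset R$ and $i\ge 0$, let $d_0(f)$ be the exponent of $x_0$ in the GLex-leading monomial of a homogeneous polynomial $f$, let $\widetilde K_i(I)=\bigoplus_{d}\{f\in I_d : d_0(f)\le i\}$, and let the $i$-th partial elimination ideal $K_i(I)\subset\bar R$ be the set of all $\bar f$, where $f=x_0^i\bar f+g\in\widetilde K_i(I)$ with $\bar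 f\in\bar R$ and $x_0$ occurring in $g$ only to powers less than $i$ (that is, $\bar f$ is the coefficient of $x_0^i$ in $f$). Let $I\subset R$ be a nonzero homogeneous ideal in generic coordinates and let $\beta=\min\{j : I_j\ne 0\}$. Then $$M(I)=\max\{\,M(K_i(I))+i \;:\; 0\le i\le\beta\,\}.$$ Moreover, every minimal monomial generator of $\mathrm{Gin}(I)$ has the form $x_0^iN$ with $0\le i\le\beta$ and $N$ a minimal monomial generator of $\mathrm{Gin}(K_i(I))$. -/

import Mathlib

noncomputable section

namespace GLexGin

open MvPolynomial

variable {k : Type*} [Field k] {n : ℕ}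

/-- Homogeneous ideals for the standard grading of the polynomial ring. -/
def IsHomogeneousIdeal {σ : Type*} (I : Ideal (MvPolynomial σ k)) : Prop :=
  letI := MvPolynomial.gradedAlgebra (σ := σ) (R := k)
  I.IsHomogeneous (homogeneousSubmodule σ k)

/-- The initial ideal `in_m(I)`: the ideal generated by the leading monomials of the nonzero
elements of `I`. -/
def initialIdeal {σ : Type*} (m : MonomialOrder σ) (I : Ideal (MvPolynomial σ k)) :
    Ideal (MvPolynomial σ k) :=
  Ideal.span {t | ∃ f ∈ I, f ≠ 0 ∧ t = monomial (m.degree f) 1}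

/-- The linear change of coordinates `x_j ↦ ∑ i, g i j • x_i` attached to a matrix `g`. -/
def coordChange (g : GL (Fin n) k) : MvPolynomial (Fin n) k →ₐ[k] MvPolynomial (Fin n) k :=
  aeval fun j => ∑ i, C (g.val i j) * X i

/-- The ideal `g(I)`. -/
def changeCoord (g : GL (Fin n) k) (I : Ideal (MvPolynomial (Fin n) k)) :
    Ideal (MvPolynomial (Fin n) k) :=
  I.map (coordChange g)

/-- Zariski open subsets of `GL_n(k)`: complements of the common zero loci of sets of polynomials
in the matrix entries (inverting the determinant does not change these zero loci). -/
def IsZariskiOpen (U : Set (GL (Fin n) k)) : Prop :=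
  ∃ S : Set (MvPolynomial (Fin n × Fin n) k),
    U = {g | ∃ p ∈ S, eval (fun ij => g.val ij.1 ij.2) p ≠ 0}

/-- `J` is the generic initial ideal of `I` for the graded lexicographic order with
`x_0 > x_1 > ⋯`: one has `in(g(I)) = J` for all `g` in a nonempty Zariski open set. -/
def IsGin (I J : Ideal (MvPolynomial (Fin n) k)) : Prop :=
  ∃ U : Set (GL (Fin n) k), IsZariskiOpen U ∧ U.Nonempty ∧
    ∀ g ∈ U, initialIdeal MonomialOrder.degLex (changeCoord g I) = J

open scoped Classical in
/-- The generic initial ideal `Gin_GLex(I)`. It exists for every homogeneous ideal over an infinite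
field and is unique; the value `⊥` is only a default. -/
def gin (I : Ideal (MvPolynomial (Fin n) k)) : Ideal (MvPolynomial (Fin n) k) :=
  if h : ∃ J, IsGin I J then h.choose else ⊥

/-- `I` is in generic coordinates (for the graded lexicographic order): the given coordinates, that
is `g = 1`, belong to a Zariski open set of `g` for which `in(g(I))` is the generic initial ideal
of `I`. -/
def InGenericCoordinates (I : Ideal (MvPolynomial (Fin n) k)) : Prop :=
  ∃ U : Set (GL (Fin n) k), IsZariskiOpen U ∧ 1 ∈ U ∧
    ∀ g ∈ U, initialIdeal MonomialOrder.degLex (changeCoord g I) = gin I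

/-- The exponents of the minimal monomial generators of a monomial ideal `J`: the monomials of `J`
that are minimal for divisibility. -/
def minGens {σ : Type*} (J : Ideal (MvPolynomial σ k)) : Set (σ →₀ ℕ) :=
  {a | Minimal (fun b : σ →₀ ℕ => monomial b (1 : k) ∈ J) a}

/-- `M(I)`: the maximal degree of a minimal generator of `Gin_GLex(I)`. The set of these degrees is
finite; for `Gin_GLex(I) = 0` it is empty and `M(I) = 0`. -/
def degComplexity (I : Ideal (MvPolynomial (Fin n) k)) : ℕ :=
  sSup {d | ∃ a ∈ minGens (gin I), d = a.degree}

/-- `d_0(f)`: the exponent of `x_0` in the leading monomial of `f` for the graded lexicographic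
order. -/
def leadPower (f : MvPolynomial (Fin (n + 1)) k) : ℕ :=
  (MonomialOrder.degLex.degree f) 0

/-- `K̃_i(I)`, the sum over all `d` of the spaces `{f ∈ I_d | d_0(f) ≤ i}`. -/
def partialElimSpace (i : ℕ) (I : Ideal (MvPolynomial (Fin (n + 1)) k)) :
    Submodule k (MvPolynomial (Fin (n + 1)) k) :=
  Submodule.span k {f | f ∈ I ∧ (∃ d, f.IsHomogeneous d) ∧ leadPower f ≤ i}

/-- The coefficient `f̄ ∈ k[x_1, …, x_n]` of `x_0 ^ i` in `f`. The variable `x_{j+1}` of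
`k[x_0, …, x_n]` is the variable with index `j` in the polynomial ring on `Fin n`. -/
def coeffX0 (i : ℕ) (f : MvPolynomial (Fin (n + 1)) k) : MvPolynomial (Fin n) k :=
  (finSuccEquiv k n f).coeff i

lemma X_succ_mul_mem_partialElimSpace {i : ℕ} {I : Ideal (MvPolynomial (Fin (n + 1)) k)}
    (j : Fin n) {f : MvPolynomial (Fin (n + 1)) k} (hf : f ∈ partialElimSpace i I) :
    X j.succ * f ∈ partialElimSpace i I := by
  induction hf using Submodule.span_induction with
  | mem f hf =>
    obtain ⟨hI, ⟨d, hd⟩, hl⟩ := hf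
    refine Submodule.subset_span ⟨I.mul_mem_left _ hI, ⟨1 + d, (isHomogeneous_X k j.succ).mul hd⟩, ?_⟩
    by_cases h0 : f = 0
    · simp [h0, leadPower]
    · unfold leadPower at *
      rw [MonomialOrder.degree_mul (X_ne_zero _) h0, MonomialOrder.degree_X]
      simpa using hl
  | zero => simp
  | add f g _ _ hf hg => rw [mul_add]; exact add_mem hf hg
  | smul c f _ hf => rw [mul_smul_comm]; exact Submodule.smul_mem _ _ hf

lemma exists_mul_coeffX0 {i : ℕ} {I : Ideal (MvPolynomial (Fin (n + 1)) k)}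
    (p : MvPolynomial (Fin n) k) :
    ∀ f ∈ partialElimSpace i I, ∃ f' ∈ partialElimSpace i I, coeffX0 i f' = p * coeffX0 i f := by
  induction p using MvPolynomial.induction_on with
  | C c =>
    intro f hf
    refine ⟨c • f, Submodule.smul_mem _ _ hf, ?_⟩
    rw [coeffX0, map_smul, Polynomial.coeff_smul, MvPolynomial.smul_eq_C_mul, coeffX0]
  | add p q hp hq =>
    intro f hf
    obtain ⟨f₁, h₁, e₁⟩ := hp f hf
    obtain ⟨f₂, h₂, e₂⟩ := hq f hf
    refine ⟨f₁ + f₂, add_mem h₁ h₂, ?_⟩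
    rw [add_mul, ← e₁, ← e₂]
    simp [coeffX0]
  | mul_X p j hp =>
    intro f hf
    obtain ⟨f₁, h₁, e₁⟩ := hp _ (X_succ_mul_mem_partialElimSpace j hf)
    refine ⟨f₁, h₁, ?_⟩
    rw [e₁, mul_assoc]
    simp [coeffX0, finSuccEquiv_X_succ]

/-- The `i`-th partial elimination ideal `K_i(I)`: the image of `K̃_i(I)` under `f ↦ f̄`, where
`f = x_0 ^ i f̄ + g` with `d_0(g) < i`; thus `f̄` is the coefficient of `x_0 ^ i` in `f`. -/
def partialElim (i : ℕ) (I : Ideal (MvPolynomial (Fin (n + 1)) k)) :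
    Ideal (MvPolynomial (Fin n) k) where
  carrier := coeffX0 i '' (partialElimSpace i I : Set (MvPolynomial (Fin (n + 1)) k))
  zero_mem' := ⟨0, Submodule.zero_mem _, by simp [coeffX0]⟩
  add_mem' := by
    rintro _ _ ⟨f, hf, rfl⟩ ⟨g, hg, rfl⟩
    exact ⟨f + g, Submodule.add_mem _ hf hg, by simp [coeffX0]⟩
  smul_mem' := by
    rintro p _ ⟨f, hf, rfl⟩
    exact exists_mul_coeffX0 p f hf

end GLexGin

end

noncomputable section

namespace GLexGin

open MvPolynomial

/-! Let `E` be the set of exponents of leading monomials of `I`. In one degree, GLex compares the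
exponent of `x_0` first, so `x_0^i N` lies in `in(I)` exactly when `N` lies in `in(K_i(I))`
(`mem_leadExponents_partialElim_iff`). Coordinate changes fixing `x_0` commute with `K_i`;
restricting the open set of good coordinates to them gives `Gin(K_i(I)) = in(K_i(I))`
(`InGenericCoordinates.gin_partialElim`). The theorem thus becomes a statement about the minimal
elements of `E` and of its slices at fixed `x_0`-exponent.

The slices interact through stability: if `x^a x_l ∈ in(I)` with `l > 0`, then `x^a x_0 ∈ in(I)`
(`InGenericCoordinates.add_single_mem_leadExponents`). To prove it, move `x_l` to `x_l + t x_0`. For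
infinitely many `t` the initial ideal is unchanged, so the map from `I_d` to polynomials modulo
`x_0`-degree at most `i` has a kernel at least as large as at `t = 0`. Its rank therefore does not
jump, and its derivative sends the kernel at `0` into the range at `0`
(`derivative_mem_range_of_rank_le`). Hence for `f` in that kernel, `x_0 ∂f/∂x_l` agrees with some
`f' ∈ I_d` modulo `x_0`-degree at most `i`. In characteristic zero the leading monomial of `f'` is
that of `f` with `x_l` traded for `x_0`.

By stability `x_0^β ∈ in(I)`, which bounds the `x_0`-exponent of minimal generators by `β`. For `i ≤
β` stability also makes each minimal generator `N` of the `i`-th slice yield a minimal generator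
`x_0^i N` of `in(I)` (`minimal_cons_of_minimal`). -/

/-- The exponents of the leading monomials of the nonzero elements of `I`. -/
def leadExponents {k σ : Type*} [Field k] (m : MonomialOrder σ) (I : Ideal (MvPolynomial σ k)) :
    Set (σ →₀ ℕ) :=
  {a | ∃ f ∈ I, f ≠ 0 ∧ m.degree f = a}

/-! ### Leading exponents and initial ideals -/

section LeadExponents

variable {k σ : Type*} [Field k] (m : MonomialOrder σ) {I : Ideal (MvPolynomial σ k)}

lemma initialIdeal_eq_span_image :
    initialIdeal m I = Ideal.span ((fun a => monomial a (1 : k)) '' leadExponents m I) := by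
  unfold initialIdeal leadExponents
  congr 1
  ext t
  constructor
  · rintro ⟨f, hf, h0, rfl⟩
    exact ⟨_, ⟨f, hf, h0, rfl⟩, rfl⟩
  · rintro ⟨_, ⟨f, hf, h0, rfl⟩, rfl⟩
    exact ⟨f, hf, h0, rfl⟩

lemma add_mem_leadExponents {a : σ →₀ ℕ} (ha : a ∈ leadExponents m I) (b : σ →₀ ℕ) :
    a + b ∈ leadExponents m I := by
  classical
  obtain ⟨f, hf, h0, rfl⟩ := ha
  have hb : monomial b (1 : k) ≠ 0 := by simp
  refine ⟨f * monomial b 1, I.mul_mem_right _ hf, mul_ne_zero h0 hb, ?_⟩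
  rw [m.degree_mul h0 hb, m.degree_monomial, if_neg one_ne_zero]

lemma monomial_mem_initialIdeal_iff {a : σ →₀ ℕ} :
    monomial a (1 : k) ∈ initialIdeal m I ↔ a ∈ leadExponents m I := by
  classical
  rw [initialIdeal_eq_span_image, mem_ideal_span_monomial_image]
  constructor
  · intro h
    obtain ⟨b, hb, hba⟩ := h a (by simp [mem_support_iff])
    obtain ⟨c, rfl⟩ := exists_add_of_le hba
    exact add_mem_leadExponents m hb c
  · intro h c hc
    rw [support_monomial, if_neg one_ne_zero, Finset.mem_singleton] at hc
    exact ⟨a, h, hc.ge⟩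

lemma initialIdeal_eq_iff {J : Ideal (MvPolynomial σ k)} :
    initialIdeal m I = initialIdeal m J ↔ leadExponents m I = leadExponents m J := by
  constructor
  · intro h
    ext a
    rw [← monomial_mem_initialIdeal_iff, h, monomial_mem_initialIdeal_iff]
  · intro h
    rw [initialIdeal_eq_span_image, initialIdeal_eq_span_image, h]

lemma degree_eq_of_forall_le {f : MvPolynomial σ k} {a : σ →₀ ℕ} (ha : coeff a f ≠ 0)
    (h : ∀ c, coeff c f ≠ 0 → m.toSyn c ≤ m.toSyn a) : m.degree f = a := by
  apply m.toSyn.injective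
  apply le_antisymm
  · exact h _ (m.coeff_degree_ne_zero_iff.2 (by rintro rfl; simp at ha))
  · exact m.le_degree (mem_support_iff.2 ha)

/-- Both dimensions are compared with the number of leading exponents of `V'`. Elements with
distinct leading exponents are independent, and an element of `V` vanishes once its coefficients at
those exponents do, because its own leading exponent is among them. -/
lemma finrank_le_of_leadExponents_subset (V V' : Submodule k (MvPolynomial σ k))
    [FiniteDimensional k V']
    (h : ∀ f ∈ V, f ≠ 0 → ∃ f' ∈ V', f' ≠ 0 ∧ m.degree f' = m.degree f) :
    Module.finrank k V ≤ Module.finrank k V' := by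
  classical
  let D : Set (σ →₀ ℕ) := {a | ∃ f ∈ V', f ≠ 0 ∧ m.degree f = a}
  choose F hFV hF0 hFd using fun a : D => a.2
  have hli : LinearIndependent k F := by
    rw [linearIndependent_iff']
    intro s g hs
    by_contra! hne
    obtain ⟨a, has, hga⟩ := hne
    obtain ⟨b, hb, hmax⟩ := (s.filter (fun i => g i ≠ 0)).exists_max_image
      (fun i => m.toSyn i.1) ⟨a, by simp [has, hga]⟩
    rw [Finset.mem_filter] at hb
    have := congrArg (coeff b.1) hs
    rw [coeff_sum, coeff_zero, Finset.sum_eq_single b] at this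
    · rw [coeff_smul, smul_eq_mul] at this
      refine mul_ne_zero hb.2 ?_ this
      have := m.coeff_degree_ne_zero_iff.2 (hF0 b)
      rwa [hFd] at this
    · intro c hc hcb
      by_cases hgc : g c = 0
      · simp [hgc]
      · rw [coeff_smul, m.coeff_eq_zero_of_lt, smul_zero]
        rw [hFd]
        refine lt_of_le_of_ne (hmax c (by simp [hc, hgc])) ?_
        intro e
        exact hcb (Subtype.ext (m.toSyn.injective e))
    · exact fun h => absurd hb.1 h
  have hli' : LinearIndependent k (fun a : D => (⟨F a, hFV a⟩ : V')) :=
    LinearIndependent.of_comp V'.subtype hli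
  have hfin : Finite D := hli'.finite
  have := Fintype.ofFinite D
  refine le_trans ?_ hli'.fintype_card_le_finrank
  let φ : V →ₗ[k] (D → k) := LinearMap.pi fun a => (lcoeff k a.1) ∘ₗ V.subtype
  have hφ : Function.Injective φ := by
    rw [injective_iff_map_eq_zero]
    intro f hf
    by_contra h0
    have h0' : (f : MvPolynomial σ k) ≠ 0 := fun e => h0 (Subtype.ext e)
    have := congrFun hf ⟨m.degree f.1, h f.1 f.2 h0'⟩
    exact m.coeff_degree_ne_zero_iff.2 h0' this
  have := LinearMap.finrank_le_finrank_of_injective hφ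
  simpa using this

end LeadExponents

/-! ### The graded lexicographic order and the variable `x_0` -/

section DegLex

variable {σ : Type*} [LinearOrder σ] [WellFoundedGT σ]

lemma degLex_lt_iff' {a b : σ →₀ ℕ} :
    MonomialOrder.degLex.toSyn a < MonomialOrder.degLex.toSyn b ↔
      a.degree < b.degree ∨ (a.degree = b.degree ∧ ∃ i, (∀ j < i, a j = b j) ∧ a i < b i) :=
  Finsupp.DegLex.lt_iff

variable {n : ℕ}

lemma degLex_lt_of_zero_lt {a b : Fin (n + 1) →₀ ℕ} (hd : a.degree = b.degree) (h : a 0 < b 0) :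
    MonomialOrder.degLex.toSyn a < MonomialOrder.degLex.toSyn b :=
  degLex_lt_iff'.2 (Or.inr ⟨hd, 0, fun j hj => absurd hj (Fin.not_lt_zero j), h⟩)

lemma degree_cons (i : ℕ) (b : Fin n →₀ ℕ) : (Finsupp.cons i b).degree = i + b.degree := by
  simp [Finsupp.degree_eq_sum, Fin.sum_univ_succ]

lemma cons_degLex_lt_cons_iff {i : ℕ} {b c : Fin n →₀ ℕ} :
    MonomialOrder.degLex.toSyn (Finsupp.cons i b) < MonomialOrder.degLex.toSyn (Finsupp.cons i c) ↔
      MonomialOrder.degLex.toSyn b < MonomialOrder.degLex.toSyn c := by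
  rw [degLex_lt_iff', degLex_lt_iff', degree_cons, degree_cons]
  simp only [add_lt_add_iff_left, add_right_inj, Fin.exists_fin_succ, Fin.forall_fin_succ,
    Finsupp.cons_zero, Finsupp.cons_succ, lt_irrefl, Fin.succ_lt_succ_iff]
  simp

lemma cons_degLex_le_cons_iff {i : ℕ} {b c : Fin n →₀ ℕ} :
    MonomialOrder.degLex.toSyn (Finsupp.cons i b) ≤ MonomialOrder.degLex.toSyn (Finsupp.cons i c) ↔
      MonomialOrder.degLex.toSyn b ≤ MonomialOrder.degLex.toSyn c := by
  rw [← not_lt, cons_degLex_lt_cons_iff, not_lt]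

end DegLex

/-- Closure under homogeneous components. -/
lemma IsHomogeneousIdeal.homogeneousComponent_mem {k σ : Type*} [Field k]
    {I : Ideal (MvPolynomial σ k)} (hI : IsHomogeneousIdeal I) {f : MvPolynomial σ k} (hf : f ∈ I)
    (d : ℕ) : homogeneousComponent d f ∈ I :=
  homogeneousComponent_mem_of_mem hI hf d

section Homogeneous

variable {k σ : Type*} [Field k] [LinearOrder σ] [WellFoundedGT σ]

lemma exists_isHomogeneous_of_mem_leadExponents {I : Ideal (MvPolynomial σ k)}
    (hI : ∀ f ∈ I, ∀ d, homogeneousComponent d f ∈ I) {a : σ →₀ ℕ}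
    (ha : a ∈ leadExponents MonomialOrder.degLex I) :
    ∃ f ∈ I, f.IsHomogeneous a.degree ∧ f ≠ 0 ∧ MonomialOrder.degLex.degree f = a := by
  classical
  obtain ⟨f, hf, h0, rfl⟩ := ha
  set a := MonomialOrder.degLex.degree f with ha
  have hc : coeff a f ≠ 0 := MonomialOrder.degLex.coeff_degree_ne_zero_iff.2 h0
  have hc' : coeff a (homogeneousComponent a.degree f) ≠ 0 := by
    rwa [coeff_homogeneousComponent, if_pos rfl]
  refine ⟨homogeneousComponent a.degree f, hI f hf _, homogeneousComponent_isHomogeneous _ _,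
    fun e => hc' (by rw [e, coeff_zero]), degree_eq_of_forall_le _ hc' fun c hc => ?_⟩
  rw [coeff_homogeneousComponent] at hc
  exact MonomialOrder.degLex.le_degree (mem_support_iff.2 fun e => hc (by simp [e]))

end Homogeneous

/-! ### Initial ideals of partial elimination ideals -/

section PartialElim

variable {k : Type*} [Field k] {n : ℕ}

/-- The polynomials in which `x_0` occurs only to powers at most `i`. -/
def powerX0LE (k : Type*) [Field k] (n i : ℕ) : Submodule k (MvPolynomial (Fin (n + 1)) k) :=
  restrictSupport k {a | a 0 ≤ i}

lemma mem_powerX0LE {i : ℕ} {f : MvPolynomial (Fin (n + 1)) k} :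
    f ∈ powerX0LE k n i ↔ ∀ a, coeff a f ≠ 0 → a 0 ≤ i := by
  simp [powerX0LE, mem_restrictSupport_iff, Set.subset_def]

lemma mem_powerX0LE_iff_coeffX0 {i : ℕ} {f : MvPolynomial (Fin (n + 1)) k} :
    f ∈ powerX0LE k n i ↔ ∀ j, i < j → coeffX0 j f = 0 := by
  rw [mem_powerX0LE]
  constructor
  · intro h j hj
    ext b
    rw [coeffX0, finSuccEquiv_coeff_coeff, coeff_zero]
    by_contra h0
    have := h _ h0
    rw [Finsupp.cons_zero] at this
    omega
  · intro h a ha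
    by_contra! hlt
    have := congrArg (coeff a.tail) (h _ hlt)
    rw [coeffX0, finSuccEquiv_coeff_coeff, Finsupp.cons_tail] at this
    exact ha this

lemma IsHomogeneous.mem_powerX0LE_iff {d i : ℕ} {f : MvPolynomial (Fin (n + 1)) k}
    (hf : f.IsHomogeneous d) : f ∈ powerX0LE k n i ↔ leadPower f ≤ i := by
  rw [mem_powerX0LE]
  by_cases h0 : f = 0
  · simp [h0, leadPower]
  have hc := MonomialOrder.degLex.coeff_degree_ne_zero_iff.2 h0
  constructor
  · intro h
    exact h _ hc
  · intro h a ha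
    refine le_trans ?_ h
    by_contra! hlt
    refine absurd (MonomialOrder.degLex.le_degree (mem_support_iff.2 ha)) (not_le.2 ?_)
    refine degLex_lt_of_zero_lt ?_ hlt
    rw [not_imp_comm.1 hf.coeff_eq_zero ha, not_imp_comm.1 hf.coeff_eq_zero hc]

variable {I : Ideal (MvPolynomial (Fin (n + 1)) k)}

/-- Both conditions on the right pass to homogeneous components, so the span of homogeneous elements
can be replaced by an intersection of subspaces. -/
lemma mem_partialElimSpace_iff (hI : ∀ f ∈ I, ∀ d, homogeneousComponent d f ∈ I) {i : ℕ}
    {f : MvPolynomial (Fin (n + 1)) k} :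
    f ∈ partialElimSpace i I ↔ f ∈ I ∧ f ∈ powerX0LE k n i := by
  classical
  constructor
  · intro hf
    have : partialElimSpace i I ≤ I.restrictScalars k ⊓ powerX0LE k n i := by
      refine Submodule.span_le.2 ?_
      rintro f ⟨hI, ⟨d, hd⟩, hl⟩
      exact ⟨hI, (IsHomogeneous.mem_powerX0LE_iff hd).2 hl⟩
    exact this hf
  · rintro ⟨hf, hi⟩
    rw [← sum_homogeneousComponent f]
    refine Submodule.sum_mem _ fun d _ => Submodule.subset_span ⟨hI f hf d,
      ⟨d, homogeneousComponent_isHomogeneous d f⟩, ?_⟩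
    rw [← IsHomogeneous.mem_powerX0LE_iff (homogeneousComponent_isHomogeneous d f), mem_powerX0LE]
    intro a ha
    rw [coeff_homogeneousComponent] at ha
    exact mem_powerX0LE.1 hi a (by rintro e; simp [e] at ha)

lemma mem_partialElim_iff (hI : ∀ f ∈ I, ∀ d, homogeneousComponent d f ∈ I) {i : ℕ}
    {h : MvPolynomial (Fin n) k} :
    h ∈ partialElim i I ↔ ∃ f ∈ I, f ∈ powerX0LE k n i ∧ coeffX0 i f = h := by
  change h ∈ coeffX0 i '' (partialElimSpace i I : Set _) ↔ _
  simp only [Set.mem_image, SetLike.mem_coe, mem_partialElimSpace_iff hI, and_assoc]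

lemma coeff_coeffX0 (i : ℕ) (b : Fin n →₀ ℕ) (f : MvPolynomial (Fin (n + 1)) k) :
    coeff b (coeffX0 i f) = coeff (Finsupp.cons i b) f :=
  finSuccEquiv_coeff_coeff b f i

/-- `in(I) = ⨁ x_0 ^ i in(K_i(I))`. -/
lemma mem_leadExponents_partialElim_iff (hI : ∀ f ∈ I, ∀ d, homogeneousComponent d f ∈ I) {i : ℕ}
    {b : Fin n →₀ ℕ} :
    b ∈ leadExponents MonomialOrder.degLex (partialElim i I) ↔
      Finsupp.cons i b ∈ leadExponents MonomialOrder.degLex I := by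
  classical
  constructor
  · rintro ⟨h, hh, h0, rfl⟩
    set b := MonomialOrder.degLex.degree h with hb
    obtain ⟨f, hf, hfi, rfl⟩ := (mem_partialElim_iff hI).1 hh
    have hc := MonomialOrder.degLex.coeff_degree_ne_zero_iff.2 h0
    rw [← hb, coeff_coeffX0] at hc
    -- The lift `f` need not be homogeneous; its component in the degree of `x_0^i x^b` keeps the
    -- term in question, and there smaller `x_0`-exponents are GLex-smaller.
    have hc' : coeff (Finsupp.cons i b)
        (homogeneousComponent (Finsupp.cons i b).degree f) ≠ 0 := by
      rwa [coeff_homogeneousComponent, if_pos rfl]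
    refine ⟨_, hI f hf (Finsupp.cons i b).degree, fun e => hc' (by rw [e, coeff_zero]),
      degree_eq_of_forall_le _ hc' fun c hc => ?_⟩
    rw [coeff_homogeneousComponent] at hc
    obtain ⟨hd, hcf⟩ : c.degree = (Finsupp.cons i b).degree ∧ coeff c f ≠ 0 := by
      by_contra h; apply hc; split_ifs with h1
      · simpa [h1] using h
      · rfl
    rcases (mem_powerX0LE.1 hfi c hcf).lt_or_eq with hlt | heq
    · exact (degLex_lt_of_zero_lt hd (by rwa [Finsupp.cons_zero])).le
    · rw [← Finsupp.cons_tail c, heq, cons_degLex_le_cons_iff]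
      refine MonomialOrder.degLex.le_degree (mem_support_iff.2 ?_)
      rwa [coeff_coeffX0, ← heq, Finsupp.cons_tail]
  · intro h
    obtain ⟨f, hf, hd, h0, hl⟩ := exists_isHomogeneous_of_mem_leadExponents hI h
    have hc : coeff b (coeffX0 i f) ≠ 0 := by
      rw [coeff_coeffX0, ← hl]
      exact MonomialOrder.degLex.coeff_degree_ne_zero_iff.2 h0
    refine ⟨coeffX0 i f, (mem_partialElim_iff hI).2 ⟨f, hf, ?_, rfl⟩,
      fun e => hc (by rw [e, coeff_zero]), degree_eq_of_forall_le _ hc fun c hc => ?_⟩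
    · rw [IsHomogeneous.mem_powerX0LE_iff hd, leadPower, hl, Finsupp.cons_zero]
    · rw [← cons_degLex_le_cons_iff (i := i), ← hl]
      rw [coeff_coeffX0] at hc
      exact MonomialOrder.degLex.le_degree (mem_support_iff.2 hc)

end PartialElim

end GLexGin

namespace GLexGin

open MvPolynomial

/-! ### Linear changes of coordinates -/

section CoordChange

variable {k : Type*} [Field k] {n : ℕ}

@[simp]
lemma coordChange_X (g : GL (Fin n) k) (j : Fin n) :
    coordChange g (X j) = ∑ i, C (g.val i j) * X i := by
  simp [coordChange]

lemma coordChange_one : coordChange (1 : GL (Fin n) k) = AlgHom.id k _ := by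
  refine algHom_ext fun j => ?_
  simp [Matrix.one_apply]

lemma coordChange_mul (g h : GL (Fin n) k) :
    coordChange (g * h) = (coordChange g).comp (coordChange h) := by
  refine algHom_ext fun j => ?_
  have hC : ∀ c : k, coordChange g (C c) = C c := fun c => (coordChange g).commutes c
  simp only [AlgHom.comp_apply, coordChange_X, map_sum, map_mul, hC, Units.val_mul,
    Matrix.mul_apply, Finset.mul_sum, Finset.sum_mul]
  rw [Finset.sum_comm]
  refine Finset.sum_congr rfl fun i _ => Finset.sum_congr rfl fun l _ => by ring

lemma coordChange_coordChange_inv (g : GL (Fin n) k) (f : MvPolynomial (Fin n) k) :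
    coordChange g (coordChange g⁻¹ f) = f := by
  rw [← AlgHom.comp_apply, ← coordChange_mul, mul_inv_cancel, coordChange_one, AlgHom.id_apply]

lemma coordChange_inv_coordChange (g : GL (Fin n) k) (f : MvPolynomial (Fin n) k) :
    coordChange g⁻¹ (coordChange g f) = f := by
  rw [← AlgHom.comp_apply, ← coordChange_mul, inv_mul_cancel, coordChange_one, AlgHom.id_apply]

lemma mem_changeCoord {g : GL (Fin n) k} {I : Ideal (MvPolynomial (Fin n) k)}
    {f : MvPolynomial (Fin n) k} : f ∈ changeCoord g I ↔ ∃ f' ∈ I, coordChange g f' = f :=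
  Ideal.mem_map_iff_of_surjective (coordChange g)
    fun f => ⟨_, coordChange_coordChange_inv g f⟩

lemma changeCoord_one (I : Ideal (MvPolynomial (Fin n) k)) : changeCoord 1 I = I := by
  ext f
  simp [mem_changeCoord, coordChange_one]

lemma isHomogeneous_coordChange (g : GL (Fin n) k) {f : MvPolynomial (Fin n) k} {d : ℕ}
    (hf : f.IsHomogeneous d) : (coordChange g f).IsHomogeneous d := by
  have := hf.aeval (fun j => ∑ i, C (g.val i j) * X i) (n := 1)
    fun j => IsHomogeneous.sum _ _ _ fun i _ => isHomogeneous_C_mul_X _ _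
  rwa [one_mul] at this

lemma homogeneousComponent_mem_changeCoord (g : GL (Fin n) k) {I : Ideal (MvPolynomial (Fin n) k)}
    (hI : ∀ f ∈ I, ∀ d, homogeneousComponent d f ∈ I) :
    ∀ f ∈ changeCoord g I, ∀ d, homogeneousComponent d f ∈ changeCoord g I := by
  intro _ hf d
  obtain ⟨f, hfI, rfl⟩ := mem_changeCoord.1 hf
  rw [← sum_homogeneousComponent f, map_sum, map_sum]
  refine Ideal.sum_mem _ fun e _ => ?_
  have he := isHomogeneous_coordChange g (homogeneousComponent_isHomogeneous e f)
  rw [homogeneousComponent_of_mem he]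
  split_ifs
  · exact mem_changeCoord.2 ⟨_, hI f hfI e, rfl⟩
  · exact Ideal.zero_mem _

end CoordChange

/-! ### Coordinate changes fixing `x_0` -/

section Extend

/-- The block diagonal matrix with blocks `1` and `A`. -/
def oneBlock {R : Type*} [CommRing R] {n : ℕ} (A : Matrix (Fin n) (Fin n) R) :
    Matrix (Fin (n + 1)) (Fin (n + 1)) R :=
  fun i j => Fin.cases (Fin.cases 1 (fun _ => 0) j) (fun i => Fin.cases 0 (fun j => A i j) j) i

section

variable {R : Type*} [CommRing R] {n : ℕ} (A : Matrix (Fin n) (Fin n) R) (i j : Fin n)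

@[simp] lemma oneBlock_zero_zero : oneBlock A 0 0 = 1 := rfl

@[simp] lemma oneBlock_zero_succ : oneBlock A 0 j.succ = 0 := rfl

@[simp] lemma oneBlock_succ_zero : oneBlock A i.succ 0 = 0 := rfl

@[simp] lemma oneBlock_succ_succ : oneBlock A i.succ j.succ = A i j := rfl

end

variable {k : Type*} [Field k] {n : ℕ}

/-- The embedding of `GL_n` in `GL_{n+1}` as the group acting on the variables other than `x_0`. -/
def extendGL : GL (Fin n) k →* GL (Fin (n + 1)) k :=
  Units.map
    { toFun := oneBlock
      map_one' := by
        ext i j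
        refine Fin.cases ?_ (fun i => ?_) i <;> refine Fin.cases ?_ (fun j => ?_) j <;>
          simp [Matrix.one_apply, Fin.succ_ne_zero, (Fin.succ_ne_zero _).symm]
      map_mul' := fun A B => by
        ext i j
        refine Fin.cases ?_ (fun i => ?_) i <;> refine Fin.cases ?_ (fun j => ?_) j <;>
          simp [Matrix.mul_apply, Fin.sum_univ_succ] }

lemma val_extendGL (g : GL (Fin n) k) : (extendGL g).val = oneBlock g.val := rfl

lemma finSuccEquiv_coordChange_extendGL (g : GL (Fin n) k) (f : MvPolynomial (Fin (n + 1)) k) :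
    finSuccEquiv k n (coordChange (extendGL g) f) =
      (finSuccEquiv k n f).map (coordChange g : MvPolynomial (Fin n) k →+* _) := by
  have : ((finSuccEquiv k n).toAlgHom).comp (coordChange (extendGL g)) =
      (Polynomial.mapAlgHom (coordChange g)).comp (finSuccEquiv k n).toAlgHom := by
    refine algHom_ext fun j => ?_
    have hC : ∀ c : k, finSuccEquiv k n (C c) = Polynomial.C (C c) := fun c => by
      simp [finSuccEquiv_apply]
    refine Fin.cases ?_ (fun j => ?_) j <;>
      simp [Fin.sum_univ_succ, val_extendGL, finSuccEquiv_X_zero, finSuccEquiv_X_succ, hC]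
  exact DFunLike.congr_fun this f

lemma coeffX0_coordChange_extendGL (g : GL (Fin n) k) (i : ℕ) (f : MvPolynomial (Fin (n + 1)) k) :
    coeffX0 i (coordChange (extendGL g) f) = coordChange g (coeffX0 i f) := by
  simp [coeffX0, finSuccEquiv_coordChange_extendGL]

lemma coordChange_extendGL_mem_powerX0LE (g : GL (Fin n) k) {i : ℕ}
    {f : MvPolynomial (Fin (n + 1)) k} (hf : f ∈ powerX0LE k n i) :
    coordChange (extendGL g) f ∈ powerX0LE k n i := by
  rw [mem_powerX0LE_iff_coeffX0] at hf ⊢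
  intro j hj
  rw [coeffX0_coordChange_extendGL, hf j hj, map_zero]

/-- The change fixes `x_0` and mixes only the other variables, so it acts on each coefficient of a
power of `x_0` separately. -/
lemma partialElim_changeCoord_extendGL {I : Ideal (MvPolynomial (Fin (n + 1)) k)}
    (hI : ∀ f ∈ I, ∀ d, homogeneousComponent d f ∈ I) (g : GL (Fin n) k) (i : ℕ) :
    partialElim i (changeCoord (extendGL g) I) = changeCoord g (partialElim i I) := by
  ext h
  rw [mem_partialElim_iff (homogeneousComponent_mem_changeCoord _ hI), mem_changeCoord]
  constructor
  · rintro ⟨_, hf, hfi, rfl⟩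
    obtain ⟨f, hfI, rfl⟩ := mem_changeCoord.1 hf
    refine ⟨coeffX0 i f, (mem_partialElim_iff hI).2 ⟨f, hfI, ?_, rfl⟩,
      (coeffX0_coordChange_extendGL g i f).symm⟩
    have := coordChange_extendGL_mem_powerX0LE g⁻¹ hfi
    rwa [map_inv, coordChange_inv_coordChange] at this
  · rintro ⟨h, hh, rfl⟩
    obtain ⟨f, hf, hfi, rfl⟩ := (mem_partialElim_iff hI).1 hh
    exact ⟨_, mem_changeCoord.2 ⟨f, hf, rfl⟩, coordChange_extendGL_mem_powerX0LE g hfi,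
      coeffX0_coordChange_extendGL g i f⟩

lemma IsZariskiOpen.preimage_extendGL {U : Set (GL (Fin (n + 1)) k)} (hU : IsZariskiOpen U) :
    IsZariskiOpen (extendGL ⁻¹' U : Set (GL (Fin n) k)) := by
  obtain ⟨S, rfl⟩ := hU
  let φ : MvPolynomial (Fin (n + 1) × Fin (n + 1)) k →ₐ[k] MvPolynomial (Fin n × Fin n) k :=
    aeval fun ij => oneBlock (Matrix.mvPolynomialX (Fin n) (Fin n) k) ij.1 ij.2
  have hφ : ∀ (g : GL (Fin n) k) p, eval (fun ij => g.val ij.1 ij.2) (φ p) =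
      eval (fun ij => (extendGL g).val ij.1 ij.2) p := by
    intro g p
    have : (aeval (R := k) (fun ij : Fin n × Fin n => g.val ij.1 ij.2)).comp φ =
        aeval (R := k) (fun ij => (extendGL g).val ij.1 ij.2) := by
      refine algHom_ext fun ij => ?_
      obtain ⟨i, j⟩ := ij
      refine Fin.cases ?_ (fun i => ?_) i <;> refine Fin.cases ?_ (fun j => ?_) j <;>
        simp [φ, val_extendGL]
    exact DFunLike.congr_fun this p
  refine ⟨φ '' S, ?_⟩
  ext g
  simp [hφ]

end Extend

/-! ### Uniqueness of the generic initial ideal, and `Gin(K_i(I))` -/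

section Gin

variable {k : Type*} [Field k] {n : ℕ}

/-- Over an infinite field the nonzero polynomial `p * q * det` has a nonvanishing point, which is
an invertible matrix in both sets. -/
lemma IsZariskiOpen.inter_nonempty [Infinite k] {U V : Set (GL (Fin n) k)} (hU : IsZariskiOpen U)
    (hV : IsZariskiOpen V) (hU' : U.Nonempty) (hV' : V.Nonempty) : (U ∩ V).Nonempty := by
  obtain ⟨S, rfl⟩ := hU
  obtain ⟨T, rfl⟩ := hV
  obtain ⟨g, p, hp, hgp⟩ := hU'
  obtain ⟨h, q, hq, hhq⟩ := hV'
  have hdet : ∀ v : Fin n × Fin n → k, eval v (Matrix.mvPolynomialX (Fin n) (Fin n) k).det =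
      (Matrix.of fun i j => v (i, j)).det := by
    intro v
    rw [RingHom.map_det]
    congr 1
    ext i j
    simp [Matrix.mvPolynomialX]
  have hp0 : p ≠ 0 := by rintro rfl; simp at hgp
  have hq0 : q ≠ 0 := by rintro rfl; simp at hhq
  have hne : p * q * (Matrix.mvPolynomialX (Fin n) (Fin n) k).det ≠ 0 :=
    mul_ne_zero (mul_ne_zero hp0 hq0) (Matrix.det_mvPolynomialX_ne_zero _ _)
  obtain ⟨v, hv⟩ : ∃ v, eval v (p * q * (Matrix.mvPolynomialX (Fin n) (Fin n) k).det) ≠ 0 := by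
    by_contra! hall
    exact hne (MvPolynomial.funext fun v => by rw [hall v, map_zero])
  rw [map_mul, map_mul, hdet] at hv
  refine ⟨Matrix.GeneralLinearGroup.mkOfDetNeZero _ (right_ne_zero_of_mul hv), ⟨p, hp, ?_⟩,
    ⟨q, hq, ?_⟩⟩
  · exact left_ne_zero_of_mul (left_ne_zero_of_mul hv)
  · exact right_ne_zero_of_mul (left_ne_zero_of_mul hv)

lemma IsGin.unique [Infinite k] {I J J' : Ideal (MvPolynomial (Fin n) k)} (h : IsGin I J)
    (h' : IsGin I J') : J = J' := by
  obtain ⟨U, hU, hne, hJ⟩ := h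
  obtain ⟨U', hU', hne', hJ'⟩ := h'
  obtain ⟨g, hg, hg'⟩ := hU.inter_nonempty hU' hne hne'
  rw [← hJ g hg, hJ' g hg']

lemma IsGin.gin_eq [Infinite k] {I J : Ideal (MvPolynomial (Fin n) k)} (h : IsGin I J) :
    gin I = J := by
  have hex : ∃ J, IsGin I J := ⟨J, h⟩
  rw [gin, dif_pos hex]
  exact hex.choose_spec.unique h

lemma InGenericCoordinates.gin_eq {I : Ideal (MvPolynomial (Fin n) k)}
    (h : InGenericCoordinates I) : gin I = initialIdeal MonomialOrder.degLex I := by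
  obtain ⟨U, -, h1, hU⟩ := h
  rw [← hU 1 h1, changeCoord_one]

/-- `Gin(K_i(I)) = in(K_i(I))` for `I` in generic coordinates. -/
lemma InGenericCoordinates.gin_partialElim [Infinite k] {I : Ideal (MvPolynomial (Fin (n + 1)) k)}
    (h : InGenericCoordinates I) (hI : ∀ f ∈ I, ∀ d, homogeneousComponent d f ∈ I) (i : ℕ) :
    gin (partialElim i I) = initialIdeal MonomialOrder.degLex (partialElim i I) := by
  refine IsGin.gin_eq ?_
  have hgin := h.gin_eq
  obtain ⟨U, hU, h1, hin⟩ := h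
  refine ⟨_, hU.preimage_extendGL, ⟨1, by simpa using h1⟩, fun g hg => ?_⟩
  have := (hin _ hg).trans hgin
  rw [initialIdeal_eq_iff] at this ⊢
  ext b
  rw [← partialElim_changeCoord_extendGL hI,
    mem_leadExponents_partialElim_iff (homogeneousComponent_mem_changeCoord _ hI), this,
    mem_leadExponents_partialElim_iff hI]

end Gin

end GLexGin

namespace GLexGin

/-! ### Families of linear maps whose rank does not jump -/

section RankConstancy

open Polynomial

variable {k W Q : Type*} [Field k] [AddCommGroup W] [Module k W] [AddCommGroup Q] [Module k Q]

/-- If the rank of a polynomial family `A t = ∑ t ^ m • c m` of linear maps does not exceed the rank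
of `A 0` for infinitely many `t`, then the derivative of the family at `0` maps `ker (A 0)` into
`range (A 0)`. -/
lemma derivative_mem_range_of_rank_le [FiniteDimensional k W] (c : ℕ → W →ₗ[k] Q)
    (A : k → W →ₗ[k] Q)
    (hA : ∀ w, ∃ N, ∀ t, A t w = ∑ m ∈ Finset.range (N + 2), t ^ m • c m w) {S : Set k}
    (hS : S.Infinite)
    (hrank : ∀ t ∈ S, Module.finrank k (LinearMap.ker (c 0)) ≤
      Module.finrank k (LinearMap.ker (A t)))
    {f : W} (hf : c 0 f = 0) : c 1 f ∈ LinearMap.range (c 0) := by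
  classical
  by_contra hnot
  let b := Module.finBasis k (LinearMap.range (c 0))
  set r := Module.finrank k (LinearMap.range (c 0))
  choose w hw using fun i : Fin r => (b i).2
  -- If `c 1 f` were outside the range of `c 0`, adjoining it to a basis of that range would give `r
  -- + 1` independent vectors.
  let v : Option (Fin r) → Q := fun o => o.elim (c 1 f) (fun i => c 0 (w i))
  have hv : LinearIndependent k v := by
    have h1 : LinearIndependent k (fun i => c 0 (w i)) := by
      have : (fun i => c 0 (w i)) = (LinearMap.range (c 0)).subtype ∘ b := funext fun i => hw i
      rw [this]
      exact b.linearIndependent.map' _ (Submodule.ker_subtype _)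
    refine linearIndependent_option.2 ⟨h1, fun hmem => hnot ?_⟩
    exact (Submodule.span_le.2 (by rintro _ ⟨i, rfl⟩; exact ⟨w i, rfl⟩)) hmem
  obtain ⟨L, hL⟩ := LinearMap.exists_leftInverse_of_injective
    (Fintype.linearCombination k v) (LinearMap.ker_eq_bot.2 hv.fintypeLinearCombination_injective)
  have hLv : ∀ o, L (v o) = Pi.single o 1 := by
    intro o
    have := DFunLike.congr_fun hL (Pi.single o (1 : k))
    simpa [Fintype.linearCombination_apply_single] using this
  choose N hN using hA
  -- The columns are the `L`-coordinates of `A t (w j)` and of `t⁻¹ • A t f`. The latter is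
  -- polynomial in `t` because `c 0 f = 0`, and its value at `0` comes from `c 1 f`. So `M` is the
  -- identity at `0`, and `det M` is a nonzero polynomial.
  let M : Matrix (Option (Fin r)) (Option (Fin r)) k[X] := fun i o =>
    o.elim (∑ m ∈ Finset.range (N f + 1), X ^ m * C (L (c (m + 1) f) i))
      (fun j => ∑ m ∈ Finset.range (N (w j) + 2), X ^ m * C (L (c m (w j)) i))
  have hMdet : ∀ t, M.det.eval t = (M.map (eval t)).det := fun t => (evalRingHom t).map_det M
  have hM0 : M.map (eval 0) = 1 := by
    ext i o
    have : (M i o).eval 0 = L (v o) i := by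
      cases o <;> simp [M, v, Finset.sum_range_succ', eval_finsetSum]
    rw [Matrix.map_apply, this, hLv, Matrix.one_apply, Pi.single_apply]
  have hM : M.det ≠ 0 := by
    intro h
    have := hMdet 0
    rw [h, hM0, Matrix.det_one, eval_zero] at this
    exact zero_ne_one this
  obtain ⟨t, ⟨htS, ht⟩⟩ :=
    (hS.sdiff ((M.det.rootSet_finite k).union (Set.finite_singleton 0))).nonempty
  have ht0 : t ≠ 0 := fun h => ht (Or.inr h)
  have hdet : (M.map (eval t)).det ≠ 0 := by
    rw [← hMdet]
    intro h
    exact ht (Or.inl (by rw [mem_rootSet]; exact ⟨hM, by simpa using h⟩))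
  let u : Option (Fin r) → W := fun o => o.elim (t⁻¹ • f) w
  have hu : ∀ o, L (A t (u o)) = (M.map (eval t)).col o := by
    intro o
    ext i
    change _ = (M i o).eval t
    cases o with
    | none =>
      simp only [u, Option.elim_none, map_smul (A t), map_smul L, hN f t, Finset.sum_range_succ' _ (N f + 1), hf, M,
        smul_zero, add_zero, map_sum, Finset.sum_apply, Pi.smul_apply, eval_finsetSum,
        smul_eq_mul, Finset.mul_sum]
      refine Finset.sum_congr rfl fun m _ => ?_
      rw [eval_mul, eval_pow, eval_X, eval_C]
      field_simp
      ring
    | some j =>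
      simp only [u, Option.elim_some, hN (w j) t, M, map_sum, map_smul L, Finset.sum_apply,
        Pi.smul_apply, eval_finsetSum, smul_eq_mul, eval_mul, eval_pow, eval_X, eval_C]
  have hli : LinearIndependent k fun o => A t (u o) := by
    refine LinearIndependent.of_comp L ?_
    have := Matrix.linearIndependent_cols_of_det_ne_zero hdet
    rwa [← funext hu] at this
  have hli' : LinearIndependent k
      fun o => (⟨A t (u o), LinearMap.mem_range_self _ _⟩ : LinearMap.range (A t)) :=
    LinearIndependent.of_comp (LinearMap.range (A t)).subtype hli
  -- The rank of `A t` is now at least `r + 1`, which rank-nullity and the assumption on kernels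
  -- forbid.
  have h1 := hli'.fintype_card_le_finrank
  rw [Fintype.card_option, Fintype.card_fin] at h1
  have h2 := LinearMap.finrank_range_add_finrank_ker (A t)
  have h3 := LinearMap.finrank_range_add_finrank_ker (c 0)
  have h4 := hrank t htS
  omega

end RankConstancy

end GLexGin

namespace GLexGin

open MvPolynomial

variable {k : Type*} [Field k] {n : ℕ}

/-! ### The family `x_l ↦ x_l + t x_0` -/

section Transvection

/-- The coordinate change `x_{l+1} ↦ x_{l+1} + t x_0`. -/
def transvectionGL (l : Fin n) (t : k) : GL (Fin (n + 1)) k :=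
  Matrix.GeneralLinearGroup.mkOfDetNeZero (Matrix.transvection 0 l.succ t) (by
    rw [Matrix.det_transvection_of_ne _ _ (Fin.succ_ne_zero l).symm]
    exact one_ne_zero)

lemma val_transvectionGL (l : Fin n) (t : k) :
    (transvectionGL l t).val = Matrix.transvection 0 l.succ t := rfl

lemma transvectionGL_zero (l : Fin n) : transvectionGL l (0 : k) = 1 :=
  Units.ext (by rw [val_transvectionGL, Matrix.transvection_zero, Units.val_one])

lemma coordChange_transvectionGL_X (l : Fin n) (t : k) (j : Fin (n + 1)) :
    coordChange (transvectionGL l t) (X j) = X j + if j = l.succ then C t * X 0 else 0 := by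
  rw [coordChange_X, val_transvectionGL, Matrix.transvection]
  simp only [Matrix.add_apply, map_add, add_mul, Finset.sum_add_distrib]
  congr 1
  · simp [Matrix.one_apply]
  · rw [Finset.sum_eq_single 0]
    · by_cases h : j = l.succ
      · subst h; simp
      · simp [h, Ne.symm h]
    · intro i _ hi
      rw [Matrix.single_apply_of_row_ne (Ne.symm hi), map_zero, zero_mul]
    · simp

/-- The family of coordinate changes `x_{l+1} ↦ x_{l+1} + t x_0`, with `t` an indeterminate. -/
def transvectionFamily (k : Type*) [Field k] (l : Fin n) :
    MvPolynomial (Fin (n + 1)) k →ₐ[k] Polynomial (MvPolynomial (Fin (n + 1)) k) :=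
  aeval fun j => Polynomial.C (X j) + if j = l.succ then Polynomial.C (X 0) * Polynomial.X else 0

lemma transvectionFamily_C (l : Fin n) (a : k) :
    transvectionFamily k l (C a) = Polynomial.C (C a) :=
  (transvectionFamily k l).commutes a

lemma transvectionFamily_X (l : Fin n) (j : Fin (n + 1)) :
    transvectionFamily k l (X j) =
      Polynomial.C (X j) + if j = l.succ then Polynomial.C (X 0) * Polynomial.X else 0 := by
  rw [transvectionFamily, aeval_X]

lemma eval_transvectionFamily (l : Fin n) (t : k) (f : MvPolynomial (Fin (n + 1)) k) :
    (transvectionFamily k l f).eval (C t) = coordChange (transvectionGL l t) f := by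
  induction f using MvPolynomial.induction_on with
  | C a =>
    rw [transvectionFamily_C, Polynomial.eval_C]
    exact ((coordChange (transvectionGL l t)).commutes a).symm
  | add p q hp hq => rw [map_add, map_add, Polynomial.eval_add, hp, hq]
  | mul_X p j hp =>
    rw [map_mul, map_mul, Polynomial.eval_mul, hp, transvectionFamily_X,
      coordChange_transvectionGL_X]
    split_ifs <;> simp [mul_comm (C t)]

lemma coeff_zero_transvectionFamily (l : Fin n) (f : MvPolynomial (Fin (n + 1)) k) :
    (transvectionFamily k l f).coeff 0 = f := by
  have := eval_transvectionFamily l 0 f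
  rwa [transvectionGL_zero, coordChange_one, C_0, ← Polynomial.coeff_zero_eq_eval_zero] at this

lemma coeff_one_transvectionFamily (l : Fin n) (f : MvPolynomial (Fin (n + 1)) k) :
    (transvectionFamily k l f).coeff 1 = pderiv l.succ f * X 0 := by
  induction f using MvPolynomial.induction_on with
  | C a => rw [transvectionFamily_C, pderiv_C]; simp
  | add p q hp hq => rw [map_add, map_add, Polynomial.coeff_add, hp, hq, add_mul]
  | mul_X p j hp =>
    rw [map_mul, Polynomial.mul_coeff_one, coeff_zero_transvectionFamily, hp,
      transvectionFamily_X, pderiv_mul]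
    by_cases h : j = l.succ
    · subst h; simp; ring
    · rw [pderiv_X_of_ne h]; simp [h]; ring

/-- A polynomial not vanishing at the identity restricts to a nonzero polynomial in `t` along this
line, hence has finitely many zeros there. -/
lemma IsZariskiOpen.infinite_transvectionGL [Infinite k] {U : Set (GL (Fin (n + 1)) k)}
    (hU : IsZariskiOpen U) (h1 : 1 ∈ U) (l : Fin n) :
    {t : k | transvectionGL l t ∈ U}.Infinite := by
  obtain ⟨S, rfl⟩ := hU
  obtain ⟨p, hp, h1⟩ := h1
  let q : Polynomial k := aeval
    (fun ij : Fin (n + 1) × Fin (n + 1) =>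
      (Matrix.transvection 0 l.succ (Polynomial.X : Polynomial k)) ij.1 ij.2) p
  have hq : ∀ t, q.eval t = eval (fun ij => (transvectionGL l t).val ij.1 ij.2) p := by
    intro t
    have : (Polynomial.aeval (R := k) t).comp (aeval (R := k)
        (fun ij : Fin (n + 1) × Fin (n + 1) =>
          (Matrix.transvection 0 l.succ (Polynomial.X : Polynomial k)) ij.1 ij.2)) =
        aeval (R := k) (fun ij => (transvectionGL l t).val ij.1 ij.2) := by
      refine algHom_ext fun ij => ?_
      simp only [AlgHom.comp_apply, aeval_X, val_transvectionGL, Matrix.transvection,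
        Matrix.add_apply, map_add, Matrix.one_apply, Matrix.single_apply]
      split_ifs <;> simp
    have := DFunLike.congr_fun this p
    rw [AlgHom.comp_apply, Polynomial.coe_aeval_eq_eval] at this
    exact this
  have hq0 : q ≠ 0 := by
    intro h
    have := hq 0
    rw [h, transvectionGL_zero, Polynomial.eval_zero] at this
    exact h1 this.symm
  refine Set.Infinite.mono (s := (q.rootSet k)ᶜ) (fun t ht => ⟨p, hp, fun h => ht ?_⟩)
    (q.rootSet_finite k).infinite_compl
  rw [Polynomial.mem_rootSet, Polynomial.coe_aeval_eq_eval, hq, h]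
  exact ⟨hq0, rfl⟩

end Transvection

/-! ### Stability in generic coordinates -/

section Stability

variable {I : Ideal (MvPolynomial (Fin (n + 1)) k)}

/-- This is the rank criterion applied to `I_d` modulo `x_0`-degree at most `i`: the `t`-derivative
at `0` of the coordinate change is `x_0 ∂/∂x_l`. -/
lemma InGenericCoordinates.exists_sub_pderiv_mem [Infinite k] (h : InGenericCoordinates I)
    (hI : ∀ f ∈ I, ∀ d, homogeneousComponent d f ∈ I) {d i : ℕ} (l : Fin n)
    {f : MvPolynomial (Fin (n + 1)) k} (hfI : f ∈ I) (hfd : f.IsHomogeneous d)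
    (hfi : f ∈ powerX0LE k n i) :
    ∃ f' ∈ I, f'.IsHomogeneous d ∧ f' - pderiv l.succ f * X 0 ∈ powerX0LE k n i := by
  have hgin := h.gin_eq
  obtain ⟨U, hU, h1, hin⟩ := h
  let W : Submodule k (MvPolynomial (Fin (n + 1)) k) :=
    I.restrictScalars k ⊓ homogeneousSubmodule (Fin (n + 1)) k d
  have hfin : FiniteDimensional k (homogeneousSubmodule (Fin (n + 1)) k d) :=
    Module.Finite.iff_fg.2 (homogeneousSubmodule_fg (Fin (n + 1)) k d)
  have hW : FiniteDimensional k W := Submodule.finiteDimensional_of_le inf_le_right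
  let π := (powerX0LE k n i).mkQ
  let c : ℕ → W →ₗ[k] (MvPolynomial (Fin (n + 1)) k ⧸ powerX0LE k n i) := fun m =>
    π ∘ₗ ((Polynomial.lcoeff (MvPolynomial (Fin (n + 1)) k) m).restrictScalars k) ∘ₗ
      (transvectionFamily k l).toLinearMap ∘ₗ W.subtype
  let B : k → W →ₗ[k] MvPolynomial (Fin (n + 1)) k := fun t =>
    (coordChange (transvectionGL l t)).toLinearMap ∘ₗ W.subtype
  have hc : ∀ m (w : W), c m w = π ((transvectionFamily k l w).coeff m) := fun _ _ => rfl
  have hc0 : ∀ w : W, c 0 w = 0 ↔ (w : MvPolynomial (Fin (n + 1)) k) ∈ powerX0LE k n i := by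
    intro w
    rw [hc, coeff_zero_transvectionFamily]
    exact Submodule.Quotient.mk_eq_zero _
  have hmem : c 1 ⟨f, hfI, hfd⟩ ∈ LinearMap.range (c 0) := by
    refine derivative_mem_range_of_rank_le c (fun t => π ∘ₗ B t) ?_
      (hU.infinite_transvectionGL h1 l) ?_ ((hc0 _).2 hfi)
    · intro w
      refine ⟨(transvectionFamily k l w).natDegree, fun t => ?_⟩
      have : B t w = (transvectionFamily k l w).eval (C t) :=
        (eval_transvectionFamily l t w).symm
      rw [LinearMap.comp_apply, this, Polynomial.eval_eq_sum_range'
        (Nat.lt_add_of_pos_right (Nat.succ_pos 1)), map_sum]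
      refine Finset.sum_congr rfl fun m _ => ?_
      rw [hc, ← map_smul, smul_eq_C_mul, map_pow, mul_comm]
    · intro t ht
      have hlead := (hin _ ht).trans hgin
      rw [initialIdeal_eq_iff] at hlead
      -- The kernel at `0` is `I_d` cut by `x_0`-degree at most `i`; the image under `B t` of the
      -- kernel at `t` is the same piece of the transformed ideal. Membership in that piece is read
      -- off the leading monomial, so equal initial ideals give the comparison of dimensions.
      refine le_trans ?_ (Submodule.finrank_map_le (B t) _)
      rw [← Submodule.finrank_map_subtype_eq]
      refine finrank_le_of_leadExponents_subset MonomialOrder.degLex _ _ ?_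
      rintro _ ⟨⟨w, hwI, hwd⟩, hw, rfl⟩ hw0
      change w ≠ 0 at hw0
      change ∃ f' ∈ _, f' ≠ 0 ∧ _ = MonomialOrder.degLex.degree w
      have hwi : w ∈ powerX0LE k n i := (hc0 _).1 hw
      have hdeg : (MonomialOrder.degLex.degree w).degree = d :=
        not_imp_comm.1 (IsHomogeneous.coeff_eq_zero hwd)
          (MonomialOrder.degLex.coeff_degree_ne_zero_iff.2 hw0)
      have hwl : MonomialOrder.degLex.degree w ∈ leadExponents MonomialOrder.degLex I :=
        ⟨w, hwI, hw0, rfl⟩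
      rw [← hlead] at hwl
      obtain ⟨f', hf', hf'd, hf'0, hf'l⟩ := exists_isHomogeneous_of_mem_leadExponents
        (homogeneousComponent_mem_changeCoord _ hI) hwl
      rw [hdeg] at hf'd
      have hf'i : f' ∈ powerX0LE k n i := by
        rw [IsHomogeneous.mem_powerX0LE_iff hf'd, leadPower, hf'l]
        exact (IsHomogeneous.mem_powerX0LE_iff hwd).1 hwi
      obtain ⟨f'', hf'', rfl⟩ := mem_changeCoord.1 hf'
      have hf''d := isHomogeneous_coordChange (transvectionGL l t)⁻¹ hf'd
      rw [coordChange_inv_coordChange] at hf''d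
      exact ⟨_, ⟨⟨f'', hf'', hf''d⟩, (Submodule.Quotient.mk_eq_zero _).2 hf'i, rfl⟩, hf'0, hf'l⟩
  obtain ⟨⟨f', hf'I, hf'd⟩, hf'⟩ := hmem
  refine ⟨f', hf'I, hf'd, ?_⟩
  rw [hc, hc, coeff_zero_transvectionFamily, coeff_one_transvectionFamily] at hf'
  exact (Submodule.Quotient.eq _).1 hf'

/-- The strong stability of the generic initial ideal with respect to `x_0`. -/
lemma InGenericCoordinates.add_single_mem_leadExponents [CharZero k] (h : InGenericCoordinates I)
    (hI : ∀ f ∈ I, ∀ d, homogeneousComponent d f ∈ I) {a : Fin (n + 1) →₀ ℕ} (l : Fin n)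
    (ha : a + Finsupp.single l.succ 1 ∈ leadExponents MonomialOrder.degLex I) :
    a + Finsupp.single 0 1 ∈ leadExponents MonomialOrder.degLex I := by
  obtain ⟨f, hfI, hfd, hf0, hfl⟩ := exists_isHomogeneous_of_mem_leadExponents hI ha
  have hfi : f ∈ powerX0LE k n (a 0) := by
    rw [IsHomogeneous.mem_powerX0LE_iff hfd, leadPower, hfl]
    simp
  obtain ⟨f', hf'I, hf'd, hf'⟩ := h.exists_sub_pderiv_mem hI l hfI hfd hfi
  -- In `x_0`-degree above `a 0` the coefficients of `f'` are those of `x_0 ∂f/∂x_l`.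
  have hcoeff : ∀ b : Fin (n + 1) →₀ ℕ, a 0 ≤ b 0 →
      coeff (b + Finsupp.single 0 1) f' =
        coeff (b + Finsupp.single l.succ 1) f * (b l.succ + 1) := by
    intro b hb
    have : coeff (b + Finsupp.single 0 1) (f' - pderiv l.succ f * X 0) = 0 := by
      by_contra hne
      have := mem_powerX0LE.1 hf' _ hne
      simp at this
      omega
    rwa [coeff_sub, coeff_mul_X, coeff_pderiv, sub_eq_zero] at this
  have hne : coeff (a + Finsupp.single 0 1) f' ≠ 0 := by
    rw [hcoeff a le_rfl]
    refine mul_ne_zero ?_ (Nat.cast_add_one_ne_zero _)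
    rw [← hfl]
    exact MonomialOrder.degLex.coeff_degree_ne_zero_iff.2 hf0
  refine ⟨f', hf'I, fun e => hne (by rw [e, coeff_zero]), degree_eq_of_forall_le _ hne ?_⟩
  intro b hb
  -- Terms with `x_0`-exponent above `a 0` come from terms of `f` by trading `x_l` for `x_0`, which
  -- preserves the order; the others have smaller `x_0`-exponent than `a + single 0 1` in the same
  -- degree.
  rcases lt_or_ge (a 0) (b 0) with hlt | hle
  · obtain ⟨b, rfl⟩ : ∃ b', b = b' + Finsupp.single 0 1 :=
      ⟨b - Finsupp.single 0 1, (tsub_add_cancel_of_le (by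
        rw [Finsupp.single_le_iff]; omega)).symm⟩
    have hab : a 0 ≤ b 0 := by simp at hlt; omega
    rw [hcoeff b hab] at hb
    have := MonomialOrder.degLex.le_degree (mem_support_iff.2 (left_ne_zero_of_mul hb))
    rw [hfl, map_add, map_add, add_le_add_iff_right] at this
    rw [map_add, map_add]
    exact add_le_add_left this _
  · refine (degLex_lt_of_zero_lt ?_ (by simp; omega)).le
    rw [not_imp_comm.1 hf'd.coeff_eq_zero hb, not_imp_comm.1 hf'd.coeff_eq_zero hne]

end Stability

end GLexGin

namespace GLexGin

open MvPolynomial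

/-! ### Minimal generators and their maximal degree -/

section MinGens

variable {k : Type*} [Field k] {n : ℕ}

lemma mem_minGens_initialIdeal_iff {σ : Type*} (m : MonomialOrder σ)
    {I : Ideal (MvPolynomial σ k)} {a : σ →₀ ℕ} :
    a ∈ minGens (initialIdeal m I) ↔ Minimal (· ∈ leadExponents m I) a := by
  simp only [minGens, Set.mem_ofPred_eq, monomial_mem_initialIdeal_iff]

/-- Dickson's lemma: the minimal generators form an antichain in a well-quasi-order. Finiteness
makes the supremum in `degComplexity` a genuine maximum. -/
lemma finite_degree_minGens (J : Ideal (MvPolynomial (Fin n) k)) :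
    {d | ∃ a ∈ minGens J, d = a.degree}.Finite := by
  have h : (minGens J).Finite :=
    (setOfPred_minimal_antichain _).finite_of_partiallyWellOrderedOn
      (Set.isPWO_of_wellQuasiOrderedLE _)
  refine (h.image Finsupp.degree).subset ?_
  rintro _ ⟨a, ha, rfl⟩
  exact ⟨a, ha, rfl⟩

lemma degree_le_degComplexity {I : Ideal (MvPolynomial (Fin n) k)} {a : Fin n →₀ ℕ}
    (ha : a ∈ minGens (gin I)) : a.degree ≤ degComplexity I :=
  le_csSup (finite_degree_minGens _).bddAbove ⟨a, ha, rfl⟩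

lemma exists_degree_eq_degComplexity {I : Ideal (MvPolynomial (Fin n) k)}
    (h : (minGens (gin I)).Nonempty) : ∃ a ∈ minGens (gin I), degComplexity I = a.degree := by
  obtain ⟨a, ha⟩ := h
  have hne : {d | ∃ a ∈ minGens (gin I), d = a.degree}.Nonempty := ⟨_, a, ha, rfl⟩
  exact Nat.sSup_mem hne (finite_degree_minGens _).bddAbove

lemma degComplexity_eq_zero {I : Ideal (MvPolynomial (Fin n) k)}
    (h : ¬ (minGens (gin I)).Nonempty) : degComplexity I = 0 := by
  rw [Set.not_nonempty_iff_eq_empty] at h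
  simp [degComplexity, h]

end MinGens

/-! ### Combinatorics of stable sets of exponents -/

section Stable

variable {n : ℕ} {E : Set (Fin (n + 1) →₀ ℕ)}

lemma cons_add_single_zero (i : ℕ) (b : Fin n →₀ ℕ) :
    Finsupp.cons i b + Finsupp.single 0 1 = Finsupp.cons (i + 1) b := by
  ext j
  refine Fin.cases ?_ (fun j => ?_) j <;> simp [Fin.succ_ne_zero]

lemma cons_add_single_succ (i : ℕ) (b : Fin n →₀ ℕ) (l : Fin n) :
    Finsupp.cons i b + Finsupp.single l.succ 1 = Finsupp.cons i (b + Finsupp.single l 1) := by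
  ext j
  refine Fin.cases ?_ (fun j => ?_) j <;> simp [Finsupp.single_apply]

lemma cons_le_cons_iff {i j : ℕ} {b c : Fin n →₀ ℕ} :
    Finsupp.cons i b ≤ Finsupp.cons j c ↔ i ≤ j ∧ b ≤ c := by
  simp [Finsupp.le_def, Fin.forall_fin_succ]

lemma exists_eq_add_single {b : Fin n →₀ ℕ} (hb : b ≠ 0) :
    ∃ (l : Fin n) (c : Fin n →₀ ℕ), b = c + Finsupp.single l 1 := by
  obtain ⟨l, hl⟩ := Finsupp.ne_iff.1 hb
  refine ⟨l, b - Finsupp.single l 1, (tsub_add_cancel_of_le ?_).symm⟩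
  rw [Finsupp.single_le_iff]
  exact Nat.one_le_iff_ne_zero.2 hl

/-- Stability trades the other variables for `x_0` one at a time, keeping the total degree. -/
lemma cons_degree_zero_mem
    (hstable : ∀ (a : Fin (n + 1) →₀ ℕ) (l : Fin n), a + Finsupp.single l.succ 1 ∈ E →
      a + Finsupp.single 0 1 ∈ E) (i : ℕ) (b : Fin n →₀ ℕ) (h : Finsupp.cons i b ∈ E) :
    Finsupp.cons (i + b.degree) 0 ∈ E := by
  induction hd : b.degree generalizing i b with
  | zero =>
    rw [Finsupp.degree_eq_zero_iff] at hd
    rwa [hd] at h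
  | succ d ih =>
    obtain ⟨l, c, rfl⟩ := exists_eq_add_single (b := b) (by rintro rfl; simp at hd)
    rw [← cons_add_single_succ] at h
    have := hstable _ _ h
    rw [cons_add_single_zero] at this
    rw [map_add, Finsupp.degree_single] at hd
    have := ih _ _ this (by omega)
    rwa [add_right_comm, add_assoc] at this

/-- For a divisor `x_0^j c` in `E`, raising `j` to `i` and minimality of `b` force `c = b`, so only
the power of `x_0` could drop. If `b = 0`, the degree would fall below `β`. Otherwise stability
turns one variable of `b` into `x_0`; since `j + 1 ≤ i`, a proper divisor of `b` then lies in the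
slice, against minimality. -/
lemma minimal_cons_of_minimal
    (hupper : ∀ a ∈ E, ∀ b, a + b ∈ E)
    (hstable : ∀ (a : Fin (n + 1) →₀ ℕ) (l : Fin n), a + Finsupp.single l.succ 1 ∈ E →
      a + Finsupp.single 0 1 ∈ E) {β : ℕ} (hβ : ∀ a ∈ E, β ≤ a.degree) {i : ℕ} (hi : i ≤ β)
    {b : Fin n →₀ ℕ} (hb : Minimal (fun b => Finsupp.cons i b ∈ E) b) :
    Minimal (· ∈ E) (Finsupp.cons i b) := by
  have hmono : ∀ {j j' : ℕ} {c : Fin n →₀ ℕ}, Finsupp.cons j c ∈ E → j ≤ j' →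
      Finsupp.cons j' c ∈ E := by
    intro j j' c hc hj
    have hle : Finsupp.cons j c ≤ Finsupp.cons j' c := cons_le_cons_iff.2 ⟨hj, le_rfl⟩
    obtain ⟨d, hd⟩ := exists_add_of_le hle
    rw [hd]
    exact hupper _ hc d
  refine ⟨hb.1, fun a ha hle => ?_⟩
  obtain ⟨j, c, rfl⟩ : ∃ j c, a = Finsupp.cons j c := ⟨_, _, (Finsupp.cons_tail a).symm⟩
  rw [cons_le_cons_iff] at hle ⊢
  obtain ⟨hji, hcb⟩ := hle
  obtain rfl : c = b := le_antisymm hcb (hb.2 (hmono ha hji) hcb)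
  refine ⟨?_, le_rfl⟩
  by_contra! hlt
  by_cases hc : c = 0
  · have := hβ _ ha
    rw [degree_cons, hc, map_zero] at this
    omega
  · obtain ⟨l, c, rfl⟩ := exists_eq_add_single hc
    rw [← cons_add_single_succ] at ha
    have h' := hstable _ _ ha
    rw [cons_add_single_zero] at h'
    have h1 : c + Finsupp.single l 1 ≤ c := hb.2 (hmono h' hlt) le_self_add
    have := h1 l
    simp at this

end Stable

end GLexGin

end

/-! ### The main theorem -/

theorem mainTheorem7 {k : Type*} [Field k] [IsAlgClosed k] [CharZero k] (r : ℕ)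
    (I : Ideal (MvPolynomial (Fin (r + 1)) k))
    (hI : GLexGin.IsHomogeneousIdeal I)
    (hgen : GLexGin.InGenericCoordinates I)
    (β : ℕ)
    (hβ : IsLeast {j : ℕ | ∃ f ∈ I, f.IsHomogeneous j ∧ f ≠ 0} β) :
    IsGreatest
        {d : ℕ | ∃ i ≤ β, d = GLexGin.degComplexity (GLexGin.partialElim i I) + i}
        (GLexGin.degComplexity I) ∧
      ∀ a ∈ GLexGin.minGens (GLexGin.gin I),
        ∃ i ≤ β, ∃ b ∈ GLexGin.minGens (GLexGin.gin (GLexGin.partialElim i I)),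
          a = Finsupp.cons i b := by
  have : Infinite k := CharZero.infinite k
  have hI' : ∀ f ∈ I, ∀ d, MvPolynomial.homogeneousComponent d f ∈ I :=
    fun f hf d => hI.homogeneousComponent_mem hf d
  set E := GLexGin.leadExponents MonomialOrder.degLex I with hE
  have hupper : ∀ a ∈ E, ∀ b, a + b ∈ E := fun a ha b => GLexGin.add_mem_leadExponents _ ha b
  have hstable : ∀ (a : Fin (r + 1) →₀ ℕ) (l : Fin r), a + Finsupp.single l.succ 1 ∈ E →
      a + Finsupp.single 0 1 ∈ E := fun a l h => hgen.add_single_mem_leadExponents hI' l h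
  have hdeg : ∀ a ∈ E, β ≤ a.degree := by
    intro a ha
    obtain ⟨f, hf, hfd, hf0, -⟩ := GLexGin.exists_isHomogeneous_of_mem_leadExponents hI' ha
    exact hβ.2 ⟨f, hf, hfd, hf0⟩
  have hgenI : ∀ a, a ∈ GLexGin.minGens (GLexGin.gin I) ↔ Minimal (· ∈ E) a := by
    intro a
    rw [hgen.gin_eq, GLexGin.mem_minGens_initialIdeal_iff]
  have hgenK : ∀ i b, b ∈ GLexGin.minGens (GLexGin.gin (GLexGin.partialElim i I)) ↔
      Minimal (fun b => Finsupp.cons i b ∈ E) b := by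
    intro i b
    rw [hgen.gin_partialElim hI', GLexGin.mem_minGens_initialIdeal_iff]
    simp only [GLexGin.mem_leadExponents_partialElim_iff hI', hE]
  -- Start from the leading monomial of a nonzero form of degree `β` in `I` and trade all its
  -- variables for `x_0`.
  have hpow : Finsupp.cons β (0 : Fin r →₀ ℕ) ∈ E := by
    obtain ⟨f, hf, hfd, hf0⟩ := hβ.1
    have hl : MonomialOrder.degLex.degree f ∈ E := ⟨f, hf, hf0, rfl⟩
    have hd := not_imp_comm.1 hfd.coeff_eq_zero
      (MonomialOrder.degLex.coeff_degree_ne_zero_iff.2 hf0)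
    rw [← Finsupp.cons_tail (MonomialOrder.degLex.degree f)] at hl hd
    rw [GLexGin.degree_cons] at hd
    have := GLexGin.cons_degree_zero_mem hstable _ _ hl
    rwa [hd] at this
  have hpowMin : Finsupp.cons β (0 : Fin r →₀ ℕ) ∈ GLexGin.minGens (GLexGin.gin I) := by
    rw [hgenI]
    exact GLexGin.minimal_cons_of_minimal hupper hstable hdeg le_rfl
      ⟨hpow, fun b _ _ => zero_le⟩
  have hsplit : ∀ a ∈ GLexGin.minGens (GLexGin.gin I),
      ∃ i ≤ β, ∃ b ∈ GLexGin.minGens (GLexGin.gin (GLexGin.partialElim i I)),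
        a = Finsupp.cons i b := by
    intro a ha
    rw [hgenI] at ha
    obtain ⟨i, b, rfl⟩ : ∃ i b, a = Finsupp.cons i b := ⟨_, _, (Finsupp.cons_tail a).symm⟩
    refine ⟨i, ?_, b, (hgenK i b).2 ⟨ha.1, fun c hc hcb => ?_⟩, rfl⟩
    · by_contra! hlt
      -- An exponent of `x_0` above `β` would make `x_0^β` a proper divisor of the generator.
      have := ha.2 hpow (GLexGin.cons_le_cons_iff.2 ⟨hlt.le, zero_le⟩)
      exact absurd (GLexGin.cons_le_cons_iff.1 this).1 (by omega)
    · exact (GLexGin.cons_le_cons_iff.1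
        (ha.2 hc (GLexGin.cons_le_cons_iff.2 ⟨le_rfl, hcb⟩))).2
  have hle : ∀ i ≤ β, GLexGin.degComplexity (GLexGin.partialElim i I) + i ≤
      GLexGin.degComplexity I := by
    intro i hi
    by_cases hne : (GLexGin.minGens (GLexGin.gin (GLexGin.partialElim i I))).Nonempty
    · obtain ⟨b, hb, hbd⟩ := GLexGin.exists_degree_eq_degComplexity hne
      have := GLexGin.degree_le_degComplexity ((hgenI _).2
        (GLexGin.minimal_cons_of_minimal hupper hstable hdeg hi ((hgenK i b).1 hb)))
      rw [GLexGin.degree_cons] at this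
      omega
    -- Without generators the complexity of `K_i(I)` is `0`, and `i ≤ β ≤ M(I)` because `x_0^β` is a
    -- minimal generator.
    · have := GLexGin.degree_le_degComplexity hpowMin
      rw [GLexGin.degree_cons, map_zero] at this
      rw [GLexGin.degComplexity_eq_zero hne]
      omega
  refine ⟨⟨?_, ?_⟩, hsplit⟩
  · obtain ⟨a, ha, had⟩ := GLexGin.exists_degree_eq_degComplexity ⟨_, hpowMin⟩
    obtain ⟨i, hi, b, hb, rfl⟩ := hsplit a ha
    refine ⟨i, hi, le_antisymm ?_ (hle i hi)⟩
    have := GLexGin.degree_le_degComplexity hb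
    rw [had, GLexGin.degree_cons]
    omega
  · rintro _ ⟨i, hi, rfl⟩
    exact hle i hi
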